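/- Let $\tau:E\to Q$ be a smooth real vector bundle of finite rank over a smooth (finite-dimensional, Hausdorff, second countable) manifold, with a Lie algebroid structure: a Lie bracket $[\![\cdot,\cdot]\!]$ on smooth sections and a smooth bundle map $\rho:E\to TQ$ over $\mathrm{id}_Q$ (the anchor) such that $[\![\sigma,f\sigma']\!]=f[\![\sigma,\sigma']\!]+(\rho(\sigma)f)\,\sigma'$ for $f\in C^\infty(Q)$. Let $k\in\mathbb N$ and let $\oplus^kE$, $\oplus^kE^*$ be the Whitney sums of $k$ copies of $E$ and of its dual. Let $\pi:P\to Q$ be either of these two bundles over $Q$. *Prolongation.* Put $\mathcal T^EP=\{(e,v)\in E_{\pi(p)}\times T_pP : p\in P,\ \rho(e)=T_p\pi(v)\}$, a vector bundle over $P$ with the Lie algebroid structure whose anchor is $(e,v)\mapsto v$ and whose bracket is the extension by the Leibniz rule of $[\![(\sigma\circ\pi,X),(\sigma'\circ\pi,X')]\!]=([\![\sigma,\sigma']\!]\circ\pi,[X,X'])$, where $\sigma,\sigma'$ are sections of $E$ and $X,X'$ are vector fields on $P$ that project to $\rho(\sigma),\rho(\sigma')$. Its differential is $df(Z)=\rho(Z)f$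 on functions, where $\rho(Z)$ is the vector field on $P$ given by the anchor, and $d\Theta(Z,W)=\rho(Z)(\Theta(W))-\rho(W)(\Theta(Z))-\Theta([\![Z,W]\!])$ on sections $\Theta$ of $(\mathcal T^EP)^*$. A map $\eta:\mathbb R^k\to P$ is an integral section of $\xi=(\xi_1,\dots,\xi_k)$, a $k$-tuple of smooth sections of $\mathcal T^EP$, if it is smooth and $\partial\eta/\partial t^A=\rho(\xi_A)\circ\eta$ on $\mathbb R^k$ for $A=1,\dots,k$. *Lagrangian side.* Let $L:\oplus^kE\to\mathbb R$ be smooth. For $b=(b_1,\dots,b_k)\in\oplus^kE$ over $q$ and $e\in E_q$, let $e^{V_A}_b\in T_b(\oplus^kE)$ be the velocity at $s=0$ of $s\mapsto(b_1,\dots,b_A+se,\dots,b_k)$. Put $J^A(e,v)=(0,e^{V_A}_b)$ for $(e,v)$ in the fibre over $b$, $\Delta_A(b)=(0,(b_A)^{V_A}_b)$, $\Theta_L^A=dL\circ J^A$, $\Omega_L^A=-d\Theta_L^A$ and $E_L=\sum_{A}\rho(\Delta_A)L-L$. The geometric Euler–Lagrange equations for a $k$-tuple $\xi_L=(\xi_L^1,\dots,\xi_L^k)$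 of smooth sections of $\mathcal T^E(\oplus^kE)$ are $\sum_{A}\iota_{\xi_L^A}\Omega_L^A=dE_L$. *Hamiltonian side.* Put $\Theta^A_c(e,v)=c_A(e)$ for $c=(c_1,\dots,c_k)\in\oplus^kE^*$ and $(e,v)$ in the fibre over $c$, and $\Omega^A=-d\Theta^A$. For $H:\oplus^kE^*\to\mathbb R$ smooth, the geometric Hamilton equations for a $k$-tuple $\xi_H=(\xi_H^1,\dots,\xi_H^k)$ of smooth sections of $\mathcal T^E(\oplus^kE^*)$ are $\sum_{A}\iota_{\xi_H^A}\Omega^A=dH$. *Legendre transformation.* Let $\mathrm{Leg}:\oplus^kE\to\oplus^kE^*$ be the fibre-preserving map with $[\mathrm{Leg}(b)]_A(e)=\frac{d}{ds}\big|_{s=0}L(b_1,\dots,b_A+se,\dots,b_k)$, and let $\mathcal T^E\mathrm{Leg}(e,v)=(e,T\mathrm{Leg}(v))$. **Theorem.** Assume that $L$ is hyperregular, that is, $\mathrm{Leg}$ is a diffeomorphism, and let $H=E_L\circ\mathrm{Leg}^{-1}$. Then $\eta\mapsto\mathrm{Leg}\circ\eta$ is a bijection from the set of maps $\eta:\mathbb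 R^k\to\oplus^kE$ that are integral sections of some solution $\xi_L$ of the geometric Euler–Lagrange equations onto the set of maps $\psi:\mathbb R^k\to\oplus^kE^*$ that are integral sections of some solution $\xi_H$ of the geometric Hamilton equations. Moreover, if $\xi_L$ is a solution of the geometric Euler–Lagrange equations, then $\xi_H^A=\mathcal T^E\mathrm{Leg}\circ\xi_L^A\circ\mathrm{Leg}^{-1}$ $(A=1,\dots,k)$ defines a solution $\xi_H$ of the geometric Hamilton equations, and $\mathrm{Leg}\circ\eta$ is an integral section of $\xi_H$ whenever $\eta$ is one of $\xi_L$. Conversely, every solution $\xi_H$ of the geometric Hamilton equations arises in this way from a solution $\xi_L$ of the geometric Euler–Lagrange equations, and $\mathrm{Leg}^{-1}\circ\psi$ is an integral section of $\xi_L$ whenever $\psi$ is one of $\xi_H$. -/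

import Mathlib

open Bundle Set Manifold
open scoped ContDiff Topology

namespace KSymplectic

/-! ### The Whitney sum `E ⊕ ⋯ ⊕ E` of `k` copies of a vector bundle -/

section WhitneySum

variable {Q : Type*} (k : ℕ)

/-- The fibre over `q` of the Whitney sum of `k` copies of `E`: the `k`-tuples in `E q`. -/
abbrev WhitneySum (E : Q → Type*) (q : Q) : Type _ := Fin k → E q

variable [TopologicalSpace Q]
  {F : Type*} [NormedAddCommGroup F] [NormedSpace ℝ F]
  {E : Q → Type*} [∀ q, AddCommGroup (E q)] [∀ q, Module ℝ (E q)]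
  [TopologicalSpace (TotalSpace F E)]

/-- The local trivialization of the Whitney sum induced componentwise by one of `E`. -/
noncomputable def whitneyPretrivialization (e : Trivialization F (π F E)) :
    Pretrivialization (Fin k → F) (π (Fin k → F) (WhitneySum k E)) where
  toFun p := ⟨p.1, fun A => (e ⟨p.1, p.2 A⟩).2⟩
  invFun p := ⟨p.1, fun A => e.symm p.1 (p.2 A)⟩
  source := TotalSpace.proj ⁻¹' e.baseSet
  target := e.baseSet ×ˢ univ
  map_source' := fun ⟨_, _⟩ h => ⟨h, mem_univ _⟩
  map_target' := fun ⟨_, _⟩ h => h.1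
  left_inv' := fun ⟨q, b⟩ h =>
    congrArg (TotalSpace.mk q) (funext fun A => e.symm_apply_apply_mk h (b A))
  right_inv' := fun ⟨q, y⟩ ⟨h, _⟩ => by
    simp only [Prod.mk_right_inj]
    funext A
    exact congrArg Prod.snd (e.apply_mk_symm h (y A))
  open_target := e.open_baseSet.prod isOpen_univ
  baseSet := e.baseSet
  open_baseSet := e.open_baseSet
  source_eq := rfl
  target_eq := rfl
  proj_toFun _ _ := rfl

theorem whitneyPretrivialization_isLinear (e : Trivialization F (π F E)) [e.IsLinear ℝ] :
    (whitneyPretrivialization k e).IsLinear ℝ where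
  linear _ hq :=
    { map_add b b' := funext fun A => (e.linear ℝ hq).map_add (b A) (b' A)
      map_smul c b := funext fun A => (e.linear ℝ hq).map_smul c (b A) }

theorem whitneyPretrivialization_symm (e : Trivialization F (π F E)) {q : Q}
    (hq : q ∈ e.baseSet) (y : Fin k → F) :
    (whitneyPretrivialization k e).symm q y = fun A => e.symm q (y A) := by
  rw [Pretrivialization.symm_apply]
  · rfl
  · exact hq

/-- The continuous linear map sending `f : F →L[ℝ] F` to its componentwise application to
`k`-tuples. -/
noncomputable def piMapL (F : Type*) [NormedAddCommGroup F] [NormedSpace ℝ F] :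
    (F →L[ℝ] F) →L[ℝ] ((Fin k → F) →L[ℝ] (Fin k → F)) :=
  ∑ A : Fin k, (ContinuousLinearMap.compL ℝ (Fin k → F) F (Fin k → F)
      (ContinuousLinearMap.single ℝ (fun _ : Fin k => F) A)) ∘L
    ((ContinuousLinearMap.compL ℝ (Fin k → F) F F).flip
      (ContinuousLinearMap.proj (R := ℝ) (φ := fun _ : Fin k => F) A))

theorem piMapL_apply (f : F →L[ℝ] F) (y : Fin k → F) :
    piMapL k F f y = fun A => f (y A) := by
  classical
  funext A
  simp [piMapL, Finset.sum_apply, Pi.single_apply]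

theorem whitney_coordChange (e e' : Trivialization F (π F E))
    [e.IsLinear ℝ] [e'.IsLinear ℝ] {q : Q} (hq : q ∈ e.baseSet ∩ e'.baseSet) (y : Fin k → F) :
    piMapL k F (e.coordChangeL ℝ e' q : F →L[ℝ] F) y =
      (whitneyPretrivialization k e' ⟨q, (whitneyPretrivialization k e).symm q y⟩).2 := by
  rw [piMapL_apply, whitneyPretrivialization_symm k e hq.1]
  funext A
  exact e.coordChangeL_apply e' hq (y A)

variable [∀ q, TopologicalSpace (E q)] [FiberBundle F E] [VectorBundle ℝ F E]

variable (F E) in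
/-- The vector prebundle defining the Whitney sum of `k` copies of `E`. -/
noncomputable def whitneyPrebundle : VectorPrebundle ℝ (Fin k → F) (WhitneySum k E) where
  pretrivializationAtlas :=
    {t | ∃ (e : Trivialization F (π F E)) (_ : MemTrivializationAtlas e),
      t = whitneyPretrivialization k e}
  pretrivialization_linear' := by
    rintro _ ⟨e, he, rfl⟩
    exact whitneyPretrivialization_isLinear k e
  pretrivializationAt q := whitneyPretrivialization k (trivializationAt F E q)
  mem_base_pretrivializationAt q := FiberBundle.mem_baseSet_trivializationAt F E q
  pretrivialization_mem_atlas q := ⟨trivializationAt F E q, inferInstance, rfl⟩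
  exists_coordChange := by
    rintro _ ⟨e, he, rfl⟩ _ ⟨e', he', rfl⟩
    exact ⟨fun q => piMapL k F (e.coordChangeL ℝ e' q : F →L[ℝ] F),
      (piMapL k F).continuous.comp_continuousOn (continuousOn_coordChange ℝ e e'),
      fun q hq y => whitney_coordChange k e e' hq y⟩
  totalSpaceMk_isInducing := by
    intro q
    let φ : E q ≃L[ℝ] F := (trivializationAt F E q).continuousLinearEquivAt ℝ q
      (FiberBundle.mem_baseSet_trivializationAt F E q)
    let ψ : (Fin k → E q) ≃L[ℝ] (Fin k → F) := ContinuousLinearEquiv.piCongrRight fun _ => φ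
    have : Topology.IsInducing fun b : Fin k → E q => (q, ψ b) :=
      Topology.isInducing_const_prod.mpr ψ.toHomeomorph.isInducing
    have h : (whitneyPretrivialization k (trivializationAt F E q) ∘ TotalSpace.mk q :
        WhitneySum k E q → Q × (Fin k → F)) = fun b => (q, ψ b) := by
      funext b
      rfl
    rw [h]
    exact this

noncomputable instance : TopologicalSpace (TotalSpace (Fin k → F) (WhitneySum k E)) :=
  (whitneyPrebundle k F E).totalSpaceTopology

noncomputable instance : FiberBundle (Fin k → F) (WhitneySum k E) :=
  (whitneyPrebundle k F E).toFiberBundle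

instance : VectorBundle ℝ (Fin k → F) (WhitneySum k E) :=
  (whitneyPrebundle k F E).toVectorBundle

variable {B : Type*} [NormedAddCommGroup B] [NormedSpace ℝ B] [ChartedSpace B Q]

instance [ContMDiffVectorBundle ∞ F E 𝓘(ℝ, B)] :
    (whitneyPrebundle k F E).IsContMDiff 𝓘(ℝ, B) ∞ where
  exists_contMDiffCoordChange := by
    rintro _ ⟨e, he, rfl⟩ _ ⟨e', he', rfl⟩
    exact ⟨fun q => piMapL k F (e.coordChangeL ℝ e' q : F →L[ℝ] F),
      (piMapL k F).contMDiff.comp_contMDiffOn (contMDiffOn_coordChangeL e e'),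
      fun q hq y => whitney_coordChange k e e' hq y⟩

instance [ContMDiffVectorBundle ∞ F E 𝓘(ℝ, B)] :
    ContMDiffVectorBundle ∞ (Fin k → F) (WhitneySum k E) 𝓘(ℝ, B) :=
  (whitneyPrebundle k F E).contMDiffVectorBundle 𝓘(ℝ, B)

end WhitneySum

/-- The dual bundle `E*`. -/
abbrev DualBundle {Q : Type*} (E : Q → Type*) [∀ q, AddCommGroup (E q)] [∀ q, Module ℝ (E q)]
    [∀ q, TopologicalSpace (E q)] (q : Q) : Type _ :=
  E q →L[ℝ] Bundle.Trivial Q ℝ q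

/-- The manifold `E ⊕ ⋯ ⊕ E` (`k` copies), for a vector bundle `E` with model fibre `F`. -/
abbrev VelocitySpace (k : ℕ) (F : Type*) {Q : Type*} (E : Q → Type*) : Type _ :=
  TotalSpace (Fin k → F) (WhitneySum k E)

/-- The manifold `E* ⊕ ⋯ ⊕ E*` (`k` copies), for a vector bundle `E` with model fibre `F`. -/
abbrev MomentumSpace (k : ℕ) (F : Type*) [NormedAddCommGroup F] [NormedSpace ℝ F]
    {Q : Type*} (E : Q → Type*) [∀ q, AddCommGroup (E q)] [∀ q, Module ℝ (E q)]
    [∀ q, TopologicalSpace (E q)] : Type _ :=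
  TotalSpace (Fin k → (F →L[ℝ] ℝ)) (WhitneySum k (DualBundle E))

/-- The model of `E ⊕ ⋯ ⊕ E`. -/
noncomputable abbrev velocityModel (k : ℕ) (B F : Type*) [NormedAddCommGroup B] [NormedSpace ℝ B]
    [NormedAddCommGroup F] [NormedSpace ℝ F] :
    ModelWithCorners ℝ (B × (Fin k → F)) (ModelProd B (Fin k → F)) :=
  𝓘(ℝ, B).prod 𝓘(ℝ, Fin k → F)

/-- The model of `E* ⊕ ⋯ ⊕ E*`. -/
noncomputable abbrev momentumModel (k : ℕ) (B F : Type*) [NormedAddCommGroup B] [NormedSpace ℝ B]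
    [NormedAddCommGroup F] [NormedSpace ℝ F] :
    ModelWithCorners ℝ (B × (Fin k → (F →L[ℝ] ℝ))) (ModelProd B (Fin k → (F →L[ℝ] ℝ))) :=
  𝓘(ℝ, B).prod 𝓘(ℝ, Fin k → (F →L[ℝ] ℝ))

/-! ### Lie algebroids -/

/-- A Lie algebroid structure on the vector bundle `E → Q`: a Lie bracket on the smooth sections
of `E` and a smooth bundle map `anchor : E → TQ` such that
`⟦σ, f τ⟧ = f ⟦σ, τ⟧ + (anchor σ)(f) τ`. -/
structure LieAlgebroid (B : Type*) [NormedAddCommGroup B] [NormedSpace ℝ B]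
    {Q : Type*} [TopologicalSpace Q] [ChartedSpace B Q] [IsManifold 𝓘(ℝ, B) ∞ Q]
    (F : Type*) [NormedAddCommGroup F] [NormedSpace ℝ F]
    (E : Q → Type*) [∀ q, AddCommGroup (E q)] [∀ q, Module ℝ (E q)]
    [∀ q, TopologicalSpace (E q)] [TopologicalSpace (TotalSpace F E)]
    [FiberBundle F E] [VectorBundle ℝ F E] where
  bracket : Cₛ^∞⟮𝓘(ℝ, B); F, E⟯ → Cₛ^∞⟮𝓘(ℝ, B); F, E⟯ → Cₛ^∞⟮𝓘(ℝ, B); F, E⟯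
  bracket_add_left : ∀ σ₁ σ₂ τ, bracket (σ₁ + σ₂) τ = bracket σ₁ τ + bracket σ₂ τ
  bracket_smul_left : ∀ (c : ℝ) (σ τ), bracket (c • σ) τ = c • bracket σ τ
  bracket_antisymm : ∀ σ τ, bracket σ τ = - bracket τ σ
  jacobi : ∀ σ₁ σ₂ σ₃, bracket σ₁ (bracket σ₂ σ₃) + bracket σ₂ (bracket σ₃ σ₁) +
    bracket σ₃ (bracket σ₁ σ₂) = 0
  anchor : ∀ q, E q →ₗ[ℝ] TangentSpace 𝓘(ℝ, B) q
  contMDiff_anchor : ContMDiff (𝓘(ℝ, B).prod 𝓘(ℝ, F)) 𝓘(ℝ, B).tangent ∞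
    (fun e : TotalSpace F E => (⟨e.1, anchor e.1 e.2⟩ : TangentBundle 𝓘(ℝ, B) Q))
  leibniz : ∀ (σ τ fτ : Cₛ^∞⟮𝓘(ℝ, B); F, E⟯) (f : Q → ℝ), ContMDiff 𝓘(ℝ, B) 𝓘(ℝ, ℝ) ∞ f →
    (∀ q, fτ q = f q • τ q) → ∀ q,
      bracket σ fτ q = f q • bracket σ τ q + mvfderiv 𝓘(ℝ, B) f q (anchor q (σ q)) • τ q

/-! ### Global sections that are constant near a point in a trivialization -/

section LocalSection

variable (B : Type*) [NormedAddCommGroup B] [NormedSpace ℝ B] [FiniteDimensional ℝ B]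
  {Q : Type*} [TopologicalSpace Q] [T2Space Q] [ChartedSpace B Q] [IsManifold 𝓘(ℝ, B) ∞ Q]

theorem exists_cutoff {q : Q} {u : Set Q} (hu : u ∈ 𝓝 q) :
    ∃ χ : Q → ℝ, ContMDiff 𝓘(ℝ, B) 𝓘(ℝ, ℝ) ∞ χ ∧ tsupport χ ⊆ u ∧ χ =ᶠ[𝓝 q] 1 := by
  obtain ⟨χ, -, hχ⟩ := (SmoothBumpFunction.nhds_basis_tsupport (I := 𝓘(ℝ, B)) q).mem_iff.mp hu
  exact ⟨χ, χ.contMDiff, hχ, χ.eventuallyEq_one⟩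

variable {F : Type*} [NormedAddCommGroup F] [NormedSpace ℝ F]
  (E : Q → Type*) [∀ q, AddCommGroup (E q)] [∀ q, Module ℝ (E q)]
  [∀ q, TopologicalSpace (E q)] [TopologicalSpace (TotalSpace F E)]
  [FiberBundle F E] [VectorBundle ℝ F E] [ContMDiffVectorBundle ∞ F E 𝓘(ℝ, B)]

theorem exists_constSection (q : Q) (u : F) : ∃ σ : Cₛ^∞⟮𝓘(ℝ, B); F, E⟯,
    ∀ᶠ q' in 𝓝 q, σ q' = (trivializationAt F E q).symm q' u := by
  obtain ⟨χ, hχ, hs, h1⟩ := exists_cutoff B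
    ((trivializationAt F E q).open_baseSet.mem_nhds (FiberBundle.mem_baseSet_trivializationAt F E q))
  refine ⟨⟨χ • fun q' => (trivializationAt F E q).symm q' u, ?_⟩, ?_⟩
  · refine ContMDiffOn.smul_section_of_tsupport hχ.contMDiffOn
      (trivializationAt F E q).open_baseSet hs ?_
    rw [(trivializationAt F E q).contMDiffOn_section_baseSet_iff]
    refine contMDiffOn_const (c := u) |>.congr fun q' hq' => ?_
    simp [(trivializationAt F E q).apply_mk_symm hq' u]
  · filter_upwards [h1] with q' hq'
    change χ q' • (trivializationAt F E q).symm q' u = _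
    rw [hq', Pi.one_apply, one_smul]

/-- A smooth section of `E` which, near `q`, is the section that is constantly `u` in the
preferred trivialization at `q`. (Its values away from `q` are irrelevant: a Lie algebroid
bracket at `q` depends only on the germs at `q`.) -/
noncomputable def constSection (q : Q) (u : F) : Cₛ^∞⟮𝓘(ℝ, B); F, E⟯ :=
  (exists_constSection B E q u).choose

theorem constSection_eventuallyEq (q : Q) (u : F) :
    ∀ᶠ q' in 𝓝 q, constSection B E q u q' = (trivializationAt F E q).symm q' u :=
  (exists_constSection B E q u).choose_spec

end LocalSection

/-! ### The prolongation `𝒯ᴱP` of a Lie algebroid over a map `pr : P → Q` -/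

section Prolongation

variable {B : Type*} [NormedAddCommGroup B] [NormedSpace ℝ B]
  {Q : Type*} [TopologicalSpace Q] [ChartedSpace B Q] [IsManifold 𝓘(ℝ, B) ∞ Q]
  {F : Type*} [NormedAddCommGroup F] [NormedSpace ℝ F]
  {E : Q → Type*} [∀ q, AddCommGroup (E q)] [∀ q, Module ℝ (E q)]
  [∀ q, TopologicalSpace (E q)] [TopologicalSpace (TotalSpace F E)]
  [FiberBundle F E] [VectorBundle ℝ F E]
  {C H : Type*} [NormedAddCommGroup C] [NormedSpace ℝ C] [TopologicalSpace H]
  {P : Type*} [TopologicalSpace P] [ChartedSpace H P]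

/-- A smooth section `p ↦ (fst p, snd p)` of the prolongation
`𝒯ᴱP = {(e, v) ∈ E × TP | anchor e = T pr (v)}` over `P`. The anchor of the prolongation is
`(e, v) ↦ v`, so that `snd` is the vector field on `P` associated with the section. -/
structure ProlongationSection (𝒜 : LieAlgebroid B F E) (J : ModelWithCorners ℝ C H)
    [IsManifold J ∞ P] (pr : P → Q) where
  fst : ∀ p : P, E (pr p)
  snd : ∀ p : P, TangentSpace J p
  contMDiff_fst : ContMDiff J (𝓘(ℝ, B).prod 𝓘(ℝ, F)) ∞
    (fun p => (⟨pr p, fst p⟩ : TotalSpace F E))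
  contMDiff_snd : ContMDiff J J.tangent ∞ (fun p => (⟨p, snd p⟩ : TangentBundle J P))
  anchor_fst : ∀ p, 𝒜.anchor (pr p) (fst p) = mfderiv J 𝓘(ℝ, B) pr p (snd p)

namespace ProlongationSection

variable {𝒜 : LieAlgebroid B F E} {J : ModelWithCorners ℝ C H} [IsManifold J ∞ P] {pr : P → Q}

/-- A section of the prolongation as a map `P → 𝒯ᴱP ⊆ E × TP`. -/
def toMap (Z : ProlongationSection 𝒜 J pr) (p : P) : TotalSpace F E × TangentBundle J P :=
  (⟨pr p, Z.fst p⟩, ⟨p, Z.snd p⟩)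

/-- The `E`-component of a section, read in the preferred trivialization of `E` at `q`. -/
def coord (Z : ProlongationSection 𝒜 J pr) (q : Q) (p : P) : F :=
  (trivializationAt F E q ⟨pr p, Z.fst p⟩).2

variable [FiniteDimensional ℝ B] [T2Space Q] [ContMDiffVectorBundle ∞ F E 𝓘(ℝ, B)]

/-- The value at `p` of the Lie bracket of two sections of the prolongation. The second component
is the bracket of the vector fields. The first one is computed at `q = pr p` in the frame
`s_u = constSection q u` of `E` near `q`: if `Z = (∑ z^α s_α, v)` and `W = (∑ w^α s_α, v')`, then
it is `∑ (v(w^γ) - v'(z^γ)) s_γ + ∑ z^α w^β ⟦s_α, s_β⟧`. This is the extension, by the Leibniz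
rule, of `⟦(σ, X), (σ', X')⟧ = (⟦σ, σ'⟧, [X, X'])` from projectable to arbitrary sections. -/
noncomputable def bracket (Z W : ProlongationSection 𝒜 J pr) (p : P) :
    E (pr p) × TangentSpace J p :=
  ((trivializationAt F E (pr p)).symm (pr p)
      (mvfderiv J (W.coord (pr p)) p (Z.snd p) - mvfderiv J (Z.coord (pr p)) p (W.snd p)) +
    𝒜.bracket (constSection B E (pr p) (Z.coord (pr p) p))
      (constSection B E (pr p) (W.coord (pr p) p)) (pr p),
  VectorField.mlieBracket J Z.snd W.snd p)

/-- The exterior differential of a 1-section `Θ` of the dual of the prolongation: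
`dΘ(Z, W) = ρ(Z)(Θ(W)) - ρ(W)(Θ(Z)) - Θ(⟦Z, W⟧)`. -/
noncomputable def extDiff (Θ : ∀ p : P, E (pr p) × TangentSpace J p → ℝ)
    (Z W : ProlongationSection 𝒜 J pr) (p : P) : ℝ :=
  mvfderiv J (fun p' => Θ p' (W.fst p', W.snd p')) p (Z.snd p)
    - mvfderiv J (fun p' => Θ p' (Z.fst p', Z.snd p')) p (W.snd p)
    - Θ p (bracket Z W p)

end ProlongationSection

/-- `η : ℝᵏ → P` is an integral section of the `k`-vector field associated, through the anchor,
with the `k`-tuple `ξ` of sections of the prolongation. -/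
def IsIntegralSection {𝒜 : LieAlgebroid B F E} {J : ModelWithCorners ℝ C H} [IsManifold J ∞ P]
    {pr : P → Q} {k : ℕ} (ξ : Fin k → ProlongationSection 𝒜 J pr)
    (η : EuclideanSpace ℝ (Fin k) → P) : Prop :=
  ContMDiff 𝓘(ℝ, EuclideanSpace ℝ (Fin k)) J ∞ η ∧
    ∀ (t : EuclideanSpace ℝ (Fin k)) (A : Fin k),
      mfderiv 𝓘(ℝ, EuclideanSpace ℝ (Fin k)) J η t (EuclideanSpace.single A (1 : ℝ)) =
        (ξ A).snd (η t)

end Prolongation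

/-! ### Vertical lifts, energy and the Legendre transformation -/

section Lagrangian

variable {k : ℕ} {B : Type*} [NormedAddCommGroup B] [NormedSpace ℝ B]
  {Q : Type*} [TopologicalSpace Q] [ChartedSpace B Q]
  {F : Type*} [NormedAddCommGroup F] [NormedSpace ℝ F]
  {E : Q → Type*} [∀ q, AddCommGroup (E q)] [∀ q, Module ℝ (E q)]
  [∀ q, TopologicalSpace (E q)] [TopologicalSpace (TotalSpace F E)]
  [FiberBundle F E] [VectorBundle ℝ F E]

/-- The curve `s ↦ (b₁, …, b_A + s e, …, b_k)` in the fibre of `E ⊕ ⋯ ⊕ E` over `q`. -/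
def translate {q : Q} (b : WhitneySum k E q) (A : Fin k) (e : E q) (s : ℝ) :
    VelocitySpace k F E :=
  ⟨q, Function.update b A (b A + s • e)⟩

variable (B) in
/-- The vertical `A`-th lift of `e` at `b`: the velocity at `s = 0` of
`s ↦ (b₁, …, b_A + s e, …, b_k)`. -/
noncomputable def verticalLift (A : Fin k) (b : VelocitySpace k F E) (e : E b.proj) :
    TangentSpace (velocityModel k B F) b :=
  mfderiv 𝓘(ℝ, ℝ) (velocityModel k B F) (translate (F := F) b.2 A e) 0 (1 : ℝ)

variable (B) in
/-- The vertical endomorphism `J^A (e, v) = (0, e^{V_A})`. -/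
noncomputable def verticalEndomorphism (A : Fin k) (b : VelocitySpace k F E)
    (z : E b.proj × TangentSpace (velocityModel k B F) b) :
    E b.proj × TangentSpace (velocityModel k B F) b :=
  (0, verticalLift B A b z.1)

variable (B) in
/-- The Liouville section `Δ_A (b) = (0, (b_A)^{V_A})`. -/
noncomputable def liouvilleSection (A : Fin k) (b : VelocitySpace k F E) :
    E b.proj × TangentSpace (velocityModel k B F) b :=
  (0, verticalLift B A b (b.2 A))

variable (B) in
/-- The Poincaré–Cartan 1-section `Θ_L^A = dL ∘ J^A`. -/
noncomputable def poincareCartan (L : VelocitySpace k F E → ℝ) (A : Fin k)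
    (b : VelocitySpace k F E) (z : E b.proj × TangentSpace (velocityModel k B F) b) : ℝ :=
  mvfderiv (velocityModel k B F) L b (verticalEndomorphism B A b z).2

variable (B) in
/-- The energy `E_L = ∑_A ρ(Δ_A) L - L`. -/
noncomputable def energy (L : VelocitySpace k F E → ℝ) (b : VelocitySpace k F E) : ℝ :=
  (∑ A, mvfderiv (velocityModel k B F) L b (liouvilleSection B A b).2) - L b

variable [ContMDiffVectorBundle ∞ F E 𝓘(ℝ, B)]

variable (B F) in
theorem contMDiff_fibre (q : Q) : ContMDiff 𝓘(ℝ, Fin k → F) (velocityModel k B F) ∞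
    (fun y : Fin k → F =>
      (⟨q, fun A => (trivializationAt F E q).symm q (y A)⟩ : VelocitySpace k F E)) := by
  have h := (trivializationAt (Fin k → F) (WhitneySum k E) q).contMDiffOn_symm
    (IB := 𝓘(ℝ, B)) (n := ∞)
  refine h.comp_contMDiff (f := fun y : Fin k → F => (q, y))
    (contMDiff_const.prodMk contMDiff_id) fun y => ?_
  rw [Trivialization.mem_target]
  exact FiberBundle.mem_baseSet_trivializationAt _ _ q

theorem hasDerivAt_translate {L : VelocitySpace k F E → ℝ}
    (hL : ContMDiff (velocityModel k B F) 𝓘(ℝ, ℝ) ∞ L) {q : Q} (b : WhitneySum k E q) :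
    ∃ f : (Fin k → F) →L[ℝ] ℝ, ∀ A e, HasDerivAt (fun s => L (translate b A e s))
      (f (Pi.single A (trivializationAt F E q ⟨q, e⟩).2)) 0 := by
  set t := trivializationAt F E q
  have hq : q ∈ t.baseSet := FiberBundle.mem_baseSet_trivializationAt _ _ q
  let G : (Fin k → F) → ℝ := fun y => L ⟨q, fun A => t.symm q (y A)⟩
  have hG : ContDiff ℝ ∞ G := contMDiff_iff_contDiff.mp (hL.comp (contMDiff_fibre B F q))
  refine ⟨fderiv ℝ G (fun A => (t ⟨q, b A⟩).2), fun A e => ?_⟩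
  let c : ℝ → Fin k → F := fun s =>
    (fun A => (t ⟨q, b A⟩).2) + s • (Pi.single A (t ⟨q, e⟩).2 : Fin k → F)
  have hc : HasDerivAt c (Pi.single A (t ⟨q, e⟩).2) 0 := by
    have h := ((hasDerivAt_id (0 : ℝ)).smul_const
      (Pi.single A (t ⟨q, e⟩).2 : Fin k → F)).const_add (fun A => (t ⟨q, b A⟩).2 : Fin k → F)
    rw [one_smul] at h
    exact h
  have hc0 : c 0 = fun A => (t ⟨q, b A⟩).2 := by simp [c]
  have hGc : HasFDerivAt G (fderiv ℝ G (fun A => (t ⟨q, b A⟩).2)) (c 0) := by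
    rw [hc0]
    exact (hG.differentiable (by simp) _).hasFDerivAt
  refine (hGc.comp_hasDerivAt 0 hc).congr_of_eventuallyEq (Filter.Eventually.of_forall fun s => ?_)
  have key : ∀ A', t.symm q (c s A') = Function.update b A (b A + s • e) A' := by
    intro A'
    have hl := t.linear ℝ hq
    by_cases h : A' = A
    · subst h
      rw [Function.update_self]
      simp only [c, Pi.add_apply, Pi.smul_apply, Pi.single_eq_same]
      rw [← hl.map_smul, ← hl.map_add, t.symm_apply_apply_mk hq]
    · rw [Function.update_of_ne h]
      simp only [c, Pi.add_apply, Pi.smul_apply, Pi.single_eq_of_ne h, smul_zero, add_zero]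
      rw [t.symm_apply_apply_mk hq]
  exact congrArg L (congrArg (TotalSpace.mk q) (funext fun A' => (key A').symm))

/-- The `A`-th component of the Legendre transformation:
`[Leg(b₁, …, b_k)]^A (e) = d/ds L(b₁, …, b_A + s e, …, b_k) |_{s = 0}`. -/
noncomputable def legendreComponent
    (L : C^∞⟮velocityModel k B F, VelocitySpace k F E; 𝓘(ℝ, ℝ), ℝ⟯) {q : Q}
    (b : WhitneySum k E q) (A : Fin k) : DualBundle E q where
  toFun e := deriv (fun s : ℝ => L (translate b A e s)) 0
  map_add' e e' := by
    obtain ⟨f, hf⟩ := hasDerivAt_translate L.contMDiff b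
    have hl := (trivializationAt F E q).linear ℝ
      (FiberBundle.mem_baseSet_trivializationAt F E q)
    rw [(hf A _).deriv, (hf A _).deriv, (hf A _).deriv, hl.map_add, Pi.single_add, map_add]
  map_smul' c e := by
    obtain ⟨f, hf⟩ := hasDerivAt_translate L.contMDiff b
    have hl := (trivializationAt F E q).linear ℝ
      (FiberBundle.mem_baseSet_trivializationAt F E q)
    rw [(hf A _).deriv, (hf A _).deriv, hl.map_smul, Pi.single_smul, map_smul]
    rfl
  cont := by
    obtain ⟨f, hf⟩ := hasDerivAt_translate L.contMDiff b
    have hφ : Continuous fun e : E q => (trivializationAt F E q ⟨q, e⟩).2 :=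
      ((trivializationAt F E q).continuousLinearEquivAt ℝ q
        (FiberBundle.mem_baseSet_trivializationAt F E q)).continuous
    refine (f.continuous.comp ((continuous_single A).comp hφ)).congr fun e => ?_
    exact (hf A e).deriv.symm

/-- The Legendre transformation `E ⊕ ⋯ ⊕ E → E* ⊕ ⋯ ⊕ E*` of the Lagrangian `L`. -/
noncomputable def legendre
    (L : C^∞⟮velocityModel k B F, VelocitySpace k F E; 𝓘(ℝ, ℝ), ℝ⟯)
    (b : VelocitySpace k F E) : MomentumSpace k F E :=
  ⟨b.proj, fun A => legendreComponent L b.2 A⟩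

/-- The map `𝒯ᴱLeg (e, v) = (e, T Leg (v))`. -/
noncomputable def prolongLegendre
    (L : C^∞⟮velocityModel k B F, VelocitySpace k F E; 𝓘(ℝ, ℝ), ℝ⟯)
    (z : TotalSpace F E × TangentBundle (velocityModel k B F) (VelocitySpace k F E)) :
    TotalSpace F E × TangentBundle (momentumModel k B F) (MomentumSpace k F E) :=
  (z.1, tangentMap (velocityModel k B F) (momentumModel k B F) (legendre L) z.2)

end Lagrangian

/-! ### The geometric field equations -/

section FieldEquations

variable {k : ℕ} {B : Type*} [NormedAddCommGroup B] [NormedSpace ℝ B] [FiniteDimensional ℝ B]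
  {Q : Type*} [TopologicalSpace Q] [T2Space Q] [ChartedSpace B Q] [IsManifold 𝓘(ℝ, B) ∞ Q]
  {F : Type*} [NormedAddCommGroup F] [NormedSpace ℝ F]
  {E : Q → Type*} [∀ q, AddCommGroup (E q)] [∀ q, Module ℝ (E q)]
  [∀ q, TopologicalSpace (E q)] [TopologicalSpace (TotalSpace F E)]
  [FiberBundle F E] [VectorBundle ℝ F E] [ContMDiffVectorBundle ∞ F E 𝓘(ℝ, B)]

/-- Sections of the Lagrangian prolongation `𝒯ᴱ(E ⊕ ⋯ ⊕ E)`. -/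
abbrev VelocitySection (k : ℕ) (𝒜 : LieAlgebroid B F E) : Type _ :=
  ProlongationSection 𝒜 (velocityModel k B F) (fun b : VelocitySpace k F E => b.proj)

/-- Sections of the Hamiltonian prolongation `𝒯ᴱ(E* ⊕ ⋯ ⊕ E*)`. -/
abbrev MomentumSection (k : ℕ) (𝒜 : LieAlgebroid B F E) : Type _ :=
  ProlongationSection 𝒜 (momentumModel k B F) (fun c : MomentumSpace k F E => c.proj)

/-- The Liouville 1-section `Θ^A_c (e, v) = c_A (e)`. -/
def liouvilleForm (A : Fin k) (c : MomentumSpace k F E)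
    (z : E c.proj × TangentSpace (momentumModel k B F) c) : ℝ :=
  c.2 A z.1

variable {𝒜 : LieAlgebroid B F E}

/-- The Poincaré–Cartan 2-section `Ω_L^A = -dΘ_L^A`. -/
noncomputable def omegaLagrangian (L : VelocitySpace k F E → ℝ) (A : Fin k)
    (Z W : VelocitySection k 𝒜) (b : VelocitySpace k F E) : ℝ :=
  - ProlongationSection.extDiff (poincareCartan B L A) Z W b

/-- The Liouville 2-section `Ω^A = -dΘ^A`. -/
noncomputable def omegaHamiltonian (A : Fin k)
    (Z W : MomentumSection k 𝒜) (c : MomentumSpace k F E) : ℝ :=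
  - ProlongationSection.extDiff (liouvilleForm A) Z W c

/-- The geometric Euler–Lagrange equations `∑_A ι_{ξ_A} Ω_L^A = d E_L`. -/
def SolvesEulerLagrange (L : VelocitySpace k F E → ℝ) (ξ : Fin k → VelocitySection k 𝒜) : Prop :=
  ∀ (W : VelocitySection k 𝒜) (b : VelocitySpace k F E),
    ∑ A, omegaLagrangian L A (ξ A) W b =
      mvfderiv (velocityModel k B F) (energy B L) b (W.snd b)

/-- The geometric Hamilton equations `∑_A ι_{ξ_A} Ω^A = d H`. -/
def SolvesHamilton (H : MomentumSpace k F E → ℝ) (ξ : Fin k → MomentumSection k 𝒜) : Prop :=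
  ∀ (W : MomentumSection k 𝒜) (c : MomentumSpace k F E),
    ∑ A, omegaHamiltonian A (ξ A) W c = mvfderiv (momentumModel k B F) H c (W.snd c)

end FieldEquations

end KSymplectic

/-! The Legendre map is a diffeomorphism over the identity of `Q`, so `𝒯ᴱLeg` identifies the two
prolongations, and every ingredient of one field equation is carried to the matching ingredient of
the other. Call two sections related when `𝒯ᴱLeg` intertwines them. Three facts carry the proof.
Brackets, and hence the differential `d`, are natural for related sections (`IsRelated.bracket_eq`,
`IsRelated.extDiff_eq`). The derivative of `L` along the vertical lift of `e` is the number that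
defines `[Leg b]_A (e)`, so `Leg` pulls `Θ^A` back to `Θ_L^A` (`poincareCartan_eq_liouvilleForm`),
and therefore `Ω^A` back to `Ω_L^A`. Finally `H ∘ Leg = E_L`. Thus both sides of the equations agree
at corresponding points on related test sections. Every section over one manifold is related to one
over the other, so related tuples solve their equations simultaneously
(`solvesHamilton_iff_solvesEulerLagrange`). Integral sections correspond by the chain rule.
Existence or uniqueness of solutions plays no role. -/

/-! ### Derivatives and Lie brackets of vector fields under diffeomorphisms. -/

section Diffeomorph

variable {C H : Type*} [NormedAddCommGroup C] [NormedSpace ℝ C] [TopologicalSpace H]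
  {P : Type*} [TopologicalSpace P] [ChartedSpace H P] {J : ModelWithCorners ℝ C H}
  {C' H' : Type*} [NormedAddCommGroup C'] [NormedSpace ℝ C'] [TopologicalSpace H']
  {P' : Type*} [TopologicalSpace P'] [ChartedSpace H' P'] {J' : ModelWithCorners ℝ C' H'}
  {G K : Type*} [NormedAddCommGroup G] [NormedSpace ℝ G] [TopologicalSpace K]
  {M : Type*} [TopologicalSpace M] [ChartedSpace K M] {I : ModelWithCorners ℝ G K}

/-- The chain rule for precomposition with a diffeomorphism needs no differentiability of the outer
map. -/
theorem Diffeomorph.mfderiv_comp_apply (Φ : P ≃ₘ⟮J, J'⟯ P') (f : P' → M) (p : P)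
    (v : TangentSpace J p) :
    mfderiv J I (f ∘ Φ) p v = mfderiv J' I f (Φ p) (mfderiv J J' Φ p v) := by
  have hΦ : MDifferentiableAt J J' Φ p := Φ.mdifferentiable (by simp) p
  by_cases hf : MDifferentiableAt J' I f (Φ p)
  · exact _root_.mfderiv_comp_apply p hf hΦ v
  -- Since `f = (f ∘ Φ) ∘ Φ⁻¹`, differentiability of `f ∘ Φ` would pass to `f`. So both derivatives
  -- take the default value zero.
  · have hg : ¬ MDifferentiableAt J I (f ∘ Φ) p := by
      intro h
      apply hf
      have h' : MDifferentiableAt J I (f ∘ Φ) (Φ.symm (Φ p)) := by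
        rwa [Φ.symm_apply_apply]
      have := h'.comp (Φ p) (Φ.symm.mdifferentiable (by simp) (Φ p))
      rwa [Function.comp_assoc, show (Φ ∘ Φ.symm : P' → P') = id from
        funext Φ.apply_symm_apply] at this
    rw [mfderiv_zero_of_not_mdifferentiableAt hf, mfderiv_zero_of_not_mdifferentiableAt hg]
    rfl

theorem Diffeomorph.mvfderiv_comp_apply (Φ : P ≃ₘ⟮J, J'⟯ P') (f : P' → G) (p : P)
    (v : TangentSpace J p) :
    mvfderiv J (f ∘ Φ) p v = mvfderiv J' f (Φ p) (mfderiv J J' Φ p v) :=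
  Φ.mfderiv_comp_apply (I := 𝓘(ℝ, G)) f p v

theorem Diffeomorph.symm_tangentMap_tangentMap (Φ : P ≃ₘ⟮J, J'⟯ P') [IsManifold J ∞ P]
    [IsManifold J' ∞ P'] (x : TangentBundle J P) :
    tangentMap J' J Φ.symm (tangentMap J J' Φ x) = x := by
  have h := congrFun (tangentMap_comp (I'' := J)
    (Φ.symm.mdifferentiable (by simp)) (Φ.mdifferentiable (by simp))) x
  have e : (Φ.symm ∘ Φ : P → P) = id := funext Φ.symm_apply_apply
  rw [Function.comp_apply, e, tangentMap_id] at h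
  exact h.symm

/-- `mpullback` applies `ContinuousLinearMap.inverse` to the derivative of `Φ`. This is a genuine
inverse once the derivative is recognised as a continuous linear equivalence. -/
theorem Diffeomorph.mpullback_apply_of_comp_eq (Φ : P ≃ₘ⟮J, J'⟯ P') {V : ∀ p, TangentSpace J p}
    {V' : ∀ p, TangentSpace J' p} {p : P} (h : V' (Φ p) = mfderiv J J' Φ p (V p)) :
    VectorField.mpullback J J' Φ V' p = V p := by
  rw [VectorField.mpullback_apply, h, ← Φ.mfderivToContinuousLinearEquiv_coe (by simp),
    ContinuousLinearMap.inverse_equiv]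
  exact ContinuousLinearEquiv.symm_apply_apply _ _

/-- The Lie bracket of vector fields is natural under diffeomorphisms. -/
theorem Diffeomorph.mlieBracket_eq (Φ : P ≃ₘ⟮J, J'⟯ P') [IsManifold J ∞ P] [IsManifold J' ∞ P']
    [CompleteSpace C] [CompleteSpace C']
    {V W : ∀ p, TangentSpace J p} {V' W' : ∀ p, TangentSpace J' p}
    (hV' : ContMDiff J' J'.tangent ∞ (fun p => (⟨p, V' p⟩ : TangentBundle J' P')))
    (hW' : ContMDiff J' J'.tangent ∞ (fun p => (⟨p, W' p⟩ : TangentBundle J' P')))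
    (hV : ∀ p, V' (Φ p) = mfderiv J J' Φ p (V p)) (hW : ∀ p, W' (Φ p) = mfderiv J J' Φ p (W p))
    (p : P) :
    VectorField.mlieBracket J' V' W' (Φ p) =
      mfderiv J J' Φ p (VectorField.mlieBracket J V W p) := by
  -- Over `ℝ`, `minSmoothness` is the identity, so smoothness of the manifolds and of `Φ` covers the
  -- `C³` and `C²` conditions of the pullback formula.
  have h3 : minSmoothness ℝ 3 ≤ ∞ := by
    rw [minSmoothness_of_isRCLikeNormedField]
    exact ENat.LEInfty.out
  have h2 : minSmoothness ℝ 2 ≤ ∞ := (minSmoothness_monotone (by norm_num)).trans h3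
  have : IsManifold J (minSmoothness ℝ 3) P := IsManifold.of_le h3
  have : IsManifold J' (minSmoothness ℝ 3) P' := IsManifold.of_le h3
  have h := VectorField.mpullback_mlieBracket (n := ∞) (hV'.mdifferentiable (by simp) (Φ p))
    (hW'.mdifferentiable (by simp) (Φ p)) Φ.contMDiffAt h2
  have eV : VectorField.mpullback J J' Φ V' = V :=
    funext fun p => Φ.mpullback_apply_of_comp_eq (hV p)
  have eW : VectorField.mpullback J J' Φ W' = W :=
    funext fun p => Φ.mpullback_apply_of_comp_eq (hW p)
  -- Now `h` expresses the bracket of `V` and `W` as the inverse derivative of `Φ` applied to the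
  -- bracket of `V'` and `W'`; applying the derivative cancels the inverse.
  rw [eV, eW, VectorField.mpullback_apply,
    ← Φ.mfderivToContinuousLinearEquiv_coe (by simp), ContinuousLinearMap.inverse_equiv] at h
  rw [← h, ← Φ.mfderivToContinuousLinearEquiv_coe (by simp)]
  exact (ContinuousLinearEquiv.apply_symm_apply _ _).symm

end Diffeomorph

namespace KSymplectic

/-! ### Related sections of prolongations, their brackets and differentials. -/

section Related

variable {B : Type*} [NormedAddCommGroup B] [NormedSpace ℝ B]
  {Q : Type*} [TopologicalSpace Q] [ChartedSpace B Q] [IsManifold 𝓘(ℝ, B) ∞ Q]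
  {F : Type*} [NormedAddCommGroup F] [NormedSpace ℝ F]
  {E : Q → Type*} [∀ q, AddCommGroup (E q)] [∀ q, Module ℝ (E q)]
  [∀ q, TopologicalSpace (E q)] [TopologicalSpace (TotalSpace F E)]
  [FiberBundle F E] [VectorBundle ℝ F E]
  {C H : Type*} [NormedAddCommGroup C] [NormedSpace ℝ C] [TopologicalSpace H]
  {P : Type*} [TopologicalSpace P] [ChartedSpace H P]
  {C' H' : Type*} [NormedAddCommGroup C'] [NormedSpace ℝ C'] [TopologicalSpace H']
  {P' : Type*} [TopologicalSpace P'] [ChartedSpace H' P']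
  {𝒜 : LieAlgebroid B F E} {J : ModelWithCorners ℝ C H} [IsManifold J ∞ P] {pr : P → Q}
  {J' : ModelWithCorners ℝ C' H'} [IsManifold J' ∞ P'] {pr' : P' → Q}

namespace ProlongationSection

/-- Sections `Z` and `Z'` of the prolongations over `P` and `P'` are `Φ`-related if
`Z' ∘ Φ = 𝒯ᴱΦ ∘ Z`, where `𝒯ᴱΦ (e, v) = (e, TΦ v)`. -/
def IsRelated (Φ : P → P') (Z : ProlongationSection 𝒜 J pr)
    (Z' : ProlongationSection 𝒜 J' pr') : Prop :=
  ∀ p, Z'.toMap (Φ p) = ((Z.toMap p).1, tangentMap J J' Φ (Z.toMap p).2)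

theorem IsRelated.snd_eq {Φ : P → P'} {Z : ProlongationSection 𝒜 J pr}
    {Z' : ProlongationSection 𝒜 J' pr'} (h : IsRelated Φ Z Z') (p : P) :
    Z'.snd (Φ p) = mfderiv J J' Φ p (Z.snd p) :=
  eq_of_heq (TotalSpace.mk.inj (congrArg Prod.snd (h p))).2

/-- Relatedness is an equation in total spaces. With the projection of `P` in the form `pr' ∘ Φ`,
both `E`-components have the same type and the equation descends to the fibre. -/
theorem IsRelated.fst_eq {Φ : P → P'} {Z : ProlongationSection 𝒜 J (pr' ∘ Φ)}
    {Z' : ProlongationSection 𝒜 J' pr'} (h : IsRelated Φ Z Z') (p : P) :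
    Z'.fst (Φ p) = Z.fst p :=
  eq_of_heq (TotalSpace.mk.inj (congrArg Prod.fst (h p))).2

/-- The pullback of a section of the prolongation by a diffeomorphism. -/
theorem exists_isRelated_of_diffeomorph (Φ : P ≃ₘ⟮J, J'⟯ P') (hpr : pr' ∘ Φ = pr)
    (Z' : ProlongationSection 𝒜 J' pr') :
    ∃ Z : ProlongationSection 𝒜 J pr, IsRelated Φ Z Z' := by
  subst hpr
  have htm (x : TangentBundle J' P') :
      tangentMap J J' Φ (tangentMap J' J Φ.symm x) = x := Φ.symm.symm_tangentMap_tangentMap x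
  let V (p : P) : TangentSpace J p :=
    (Φ.mfderivToContinuousLinearEquiv (by simp) p).symm (Z'.snd (Φ p))
  have hV (p : P) : mfderiv J J' Φ p (V p) = Z'.snd (Φ p) := by
    rw [← Φ.mfderivToContinuousLinearEquiv_coe (by simp)]
    exact ContinuousLinearEquiv.apply_symm_apply _ _
  have hVT (p : P) : tangentMap J J' Φ ⟨p, V p⟩ = ⟨Φ p, Z'.snd (Φ p)⟩ :=
    congrArg (TotalSpace.mk (Φ p)) (hV p)
  refine ⟨⟨fun p => Z'.fst (Φ p), V, Z'.contMDiff_fst.comp Φ.contMDiff, ?_, fun p => ?_⟩,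
    fun p => ?_⟩
  -- As a map `P → TP`, `V` is `TΦ⁻¹ ∘ Z'.snd ∘ Φ`, a composite of smooth maps; its fibrewise
  -- definition does not show this.
  · have hsm : ContMDiff J J.tangent ∞ (tangentMap J' J Φ.symm ∘
        (fun p => (⟨p, Z'.snd p⟩ : TangentBundle J' P')) ∘ Φ) :=
      (Φ.symm.contMDiff.contMDiff_tangentMap (by simp)).comp
        (Z'.contMDiff_snd.comp Φ.contMDiff)
    convert! hsm using 2 with p
    rw [Function.comp_apply, Function.comp_apply, ← hVT, Φ.symm_tangentMap_tangentMap]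
  -- The anchor condition follows from `T(pr' ∘ Φ) = T pr' ∘ TΦ`, in the form that asks nothing of
  -- `pr'`.
  · rw [Φ.mfderiv_comp_apply, hV]
    exact Z'.anchor_fst (Φ p)
  · exact Prod.ext rfl (hVT p).symm

/-- `TΦ⁻¹` inverts `TΦ`. Pushing forward by `Φ` thereby reduces to pulling back by `Φ⁻¹`. -/
theorem IsRelated.symm {Φ : P ≃ₘ⟮J, J'⟯ P'} {Z : ProlongationSection 𝒜 J pr}
    {Z' : ProlongationSection 𝒜 J' pr'} (h : IsRelated Φ Z Z') : IsRelated Φ.symm Z' Z := by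
  intro c
  have hc := h (Φ.symm c)
  rw [Φ.apply_symm_apply] at hc
  rw [hc, Φ.symm_tangentMap_tangentMap]

/-- The pushforward of a section of the prolongation by a diffeomorphism. -/
theorem exists_isRelated_to_of_diffeomorph (Φ : P ≃ₘ⟮J, J'⟯ P') (hpr : pr' ∘ Φ = pr)
    (Z : ProlongationSection 𝒜 J pr) :
    ∃ Z' : ProlongationSection 𝒜 J' pr', IsRelated Φ Z Z' := by
  obtain ⟨Z', h⟩ := exists_isRelated_of_diffeomorph Φ.symm (pr := pr') (pr' := pr)
    (by rw [← hpr]; exact funext fun c => congrArg pr' (Φ.apply_symm_apply c)) Z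
  exact ⟨Z', h.symm⟩

/-- Relatedness leaves the `E`-component unchanged, and both sides read it in the same
trivialization at `q`. -/
theorem IsRelated.coord_eq {Φ : P → P'} {Z : ProlongationSection 𝒜 J (pr' ∘ Φ)}
    {Z' : ProlongationSection 𝒜 J' pr'} (h : IsRelated Φ Z Z') (q : Q) :
    Z.coord q = Z'.coord q ∘ Φ := by
  funext p
  exact congrArg (fun e => (trivializationAt F E q ⟨pr' (Φ p), e⟩).2) (h.fst_eq p).symm

variable [FiniteDimensional ℝ B] [T2Space Q] [ContMDiffVectorBundle ∞ F E 𝓘(ℝ, B)]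

/-- The bracket of the prolongation is natural under diffeomorphisms over the base. -/
theorem IsRelated.bracket_eq [CompleteSpace C] [CompleteSpace C'] {Φ : P ≃ₘ⟮J, J'⟯ P'}
    {Z W : ProlongationSection 𝒜 J (pr' ∘ Φ)} {Z' W' : ProlongationSection 𝒜 J' pr'}
    (hZ : IsRelated Φ Z Z') (hW : IsRelated Φ W W') (p : P) :
    bracket Z' W' (Φ p) = ((bracket Z W p).1, mfderiv J J' Φ p (bracket Z W p).2) := by
  refine Prod.ext ?_
    (Φ.mlieBracket_eq Z'.contMDiff_snd W'.contMDiff_snd hZ.snd_eq hW.snd_eq p)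
  simp only [bracket]
  -- The derivatives of the coordinates agree by the chain rule. The term with `𝒜.bracket` depends
  -- only on the base point and the coordinate values, which are common to both sides.
  rw [hZ.coord_eq, hW.coord_eq, Φ.mvfderiv_comp_apply, Φ.mvfderiv_comp_apply, hZ.snd_eq,
    hW.snd_eq]
  rfl

/-- The exterior differential commutes with pullback by a diffeomorphism over the base. -/
theorem IsRelated.extDiff_eq [CompleteSpace C] [CompleteSpace C'] {Φ : P ≃ₘ⟮J, J'⟯ P'}
    (hpr : pr' ∘ Φ = pr) {Z W : ProlongationSection 𝒜 J pr} {Z' W' : ProlongationSection 𝒜 J' pr'}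
    (hZ : IsRelated Φ Z Z') (hW : IsRelated Φ W W')
    {Θ : ∀ p : P, E (pr p) × TangentSpace J p → ℝ}
    {Θ' : ∀ p : P', E (pr' p) × TangentSpace J' p → ℝ}
    (hΘ : ∀ p e e' v, (⟨pr p, e⟩ : TotalSpace F E) = ⟨pr' (Φ p), e'⟩ →
      Θ p (e, v) = Θ' (Φ p) (e', mfderiv J J' Φ p v)) (p : P) :
    extDiff Θ' Z' W' (Φ p) = extDiff Θ Z W p := by
  -- Afterwards `p` and `Φ p` have definitionally equal base points, so the total-space equation
  -- that `hΘ` asks for is `rfl`.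
  subst hpr
  have key {X : ProlongationSection 𝒜 J (pr' ∘ Φ)} {X' : ProlongationSection 𝒜 J' pr'}
      (hX : IsRelated Φ X X') :
      (fun p => Θ p (X.fst p, X.snd p)) = (fun p => Θ' p (X'.fst p, X'.snd p)) ∘ Φ := by
    funext p
    rw [hΘ p _ (X.fst p) _ rfl, Function.comp_apply, hX.fst_eq, hX.snd_eq]
  have hb : Θ' (Φ p) (bracket Z' W' (Φ p)) = Θ p (bracket Z W p) := by
    rw [hZ.bracket_eq hW]
    exact (hΘ p _ _ _ rfl).symm
  simp only [extDiff]
  rw [key hZ, key hW, Φ.mvfderiv_comp_apply, Φ.mvfderiv_comp_apply, hb, hZ.snd_eq, hW.snd_eq]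

end ProlongationSection

/-- A diffeomorphism maps integral sections to integral sections of the related sections. -/
theorem IsIntegralSection.comp_of_isRelated {k : ℕ} {Φ : P ≃ₘ⟮J, J'⟯ P'}
    {ξ : Fin k → ProlongationSection 𝒜 J pr} {ξ' : Fin k → ProlongationSection 𝒜 J' pr'}
    (h : ∀ A, (ξ A).IsRelated Φ (ξ' A)) {η : EuclideanSpace ℝ (Fin k) → P}
    (hη : IsIntegralSection ξ η) : IsIntegralSection ξ' (Φ ∘ η) := by
  refine ⟨Φ.contMDiff.comp hη.1, fun t A => ?_⟩
  refine (mfderiv_comp_apply t (Φ.mdifferentiable (by simp) _)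
    (hη.1.mdifferentiable (by simp) t) _).trans ?_
  rw [Function.comp_apply, (h A).snd_eq]
  exact congrArg (mfderiv J J' Φ (η t)) (hη.2 t A)

end Related

/-! ### The Legendre transformation and the field equations. -/

section Legendre

variable {k : ℕ} {B : Type*} [NormedAddCommGroup B] [NormedSpace ℝ B] [FiniteDimensional ℝ B]
  {Q : Type*} [TopologicalSpace Q] [T2Space Q] [ChartedSpace B Q] [IsManifold 𝓘(ℝ, B) ∞ Q]
  {F : Type*} [NormedAddCommGroup F] [NormedSpace ℝ F]
  {E : Q → Type*} [∀ q, AddCommGroup (E q)] [∀ q, Module ℝ (E q)]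
  [∀ q, TopologicalSpace (E q)] [TopologicalSpace (TotalSpace F E)]
  [FiberBundle F E] [VectorBundle ℝ F E] [ContMDiffVectorBundle ∞ F E 𝓘(ℝ, B)]

-- In a trivialization the curve is affine in `s`. Its smoothness justifies the chain rule for `L`
-- along the curve whose velocity is the vertical lift.
omit [FiniteDimensional ℝ B] [T2Space Q] [IsManifold 𝓘(ℝ, B) ∞ Q] in
theorem contMDiff_translate {q : Q} (b : WhitneySum k E q) (A : Fin k) (e : E q) :
    ContMDiff 𝓘(ℝ, ℝ) (velocityModel k B F) ∞ (translate (F := F) b A e) := by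
  set t := trivializationAt F E q
  have hq : q ∈ t.baseSet := FiberBundle.mem_baseSet_trivializationAt _ _ q
  have hl := t.linear ℝ hq
  have hc : ContDiff ℝ ∞ fun s : ℝ =>
      Function.update (fun A' => (t ⟨q, b A'⟩).2) A ((t ⟨q, b A⟩).2 + s • (t ⟨q, e⟩).2) := by
    refine contDiff_pi.2 fun A' => ?_
    by_cases h : A' = A
    · subst h
      simp only [Function.update_self]
      fun_prop
    · simp only [Function.update_of_ne h]
      fun_prop
  refine ((contMDiff_fibre B F q).comp hc.contMDiff).congr fun s => ?_
  refine congrArg (TotalSpace.mk q) (funext fun A' => ?_)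
  by_cases h : A' = A
  · subst h
    simp only [Function.update_self]
    rw [← hl.map_smul, ← hl.map_add, t.symm_apply_apply_mk hq]
  · simp only [Function.update_of_ne h]
    rw [t.symm_apply_apply_mk hq]

omit [FiniteDimensional ℝ B] [T2Space Q] [IsManifold 𝓘(ℝ, B) ∞ Q] in
/-- The Legendre transformation pulls the Liouville 1-sections back to the Poincaré–Cartan
1-sections. -/
theorem poincareCartan_eq_legendreComponent
    (L : C^∞⟮velocityModel k B F, VelocitySpace k F E; 𝓘(ℝ, ℝ), ℝ⟯) (A : Fin k)
    (b : VelocitySpace k F E) (z : E b.proj × TangentSpace (velocityModel k B F) b) :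
    poincareCartan B L A b z = legendreComponent L b.2 A z.1 := by
  have h0 : translate (F := F) b.2 A z.1 0 = b := by
    simp [translate]
  have hL : MDifferentiableAt (velocityModel k B F) 𝓘(ℝ, ℝ) L (translate (F := F) b.2 A z.1 0) :=
    L.contMDiff.mdifferentiable (by simp) _
  have hT := (contMDiff_translate (B := B) (F := F) b.2 A z.1).mdifferentiable (by simp) 0
  -- At `s = 0` the chain rule equates `dL` on the vertical lift with the derivative of `L` along
  -- the curve, which defines the Legendre component.
  have h := mvfderiv_comp_apply (0 : ℝ) hL hT (1 : ℝ)
  rw [h0] at h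
  refine h.symm.trans ?_
  change mfderiv 𝓘(ℝ, ℝ) 𝓘(ℝ, ℝ) _ 0 (1 : ℝ) = deriv _ 0
  rw [mfderiv_eq_fderiv]
  rfl

variable {𝒜 : LieAlgebroid B F E}
  {L : C^∞⟮velocityModel k B F, VelocitySpace k F E; 𝓘(ℝ, ℝ), ℝ⟯}
  {Leg : VelocitySpace k F E ≃ₘ⟮velocityModel k B F, momentumModel k B F⟯ MomentumSpace k F E}

omit [FiniteDimensional ℝ B] [T2Space Q] [IsManifold 𝓘(ℝ, B) ∞ Q] in
theorem proj_comp_of_eq_legendre (hLeg : ∀ b, Leg b = legendre L b) :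
    (fun c : MomentumSpace k F E => c.proj) ∘ Leg = fun b : VelocitySpace k F E => b.proj :=
  funext fun b => congrArg TotalSpace.proj (hLeg b)

omit [FiniteDimensional ℝ B] [T2Space Q] [IsManifold 𝓘(ℝ, B) ∞ Q] in
theorem poincareCartan_eq_liouvilleForm (hLeg : ∀ b, Leg b = legendre L b) (A : Fin k)
    (b : VelocitySpace k F E) (e : E b.proj) (e' : E (Leg b).proj)
    (v : TangentSpace (velocityModel k B F) b) (w : TangentSpace (momentumModel k B F) (Leg b))
    (h : (⟨b.proj, e⟩ : TotalSpace F E) = ⟨(Leg b).proj, e'⟩) :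
    poincareCartan B L A b (e, v) = liouvilleForm A (Leg b) (e', w) := by
  rw [poincareCartan_eq_legendreComponent]
  change _ = (Leg b).2 A e'
  -- The types of `w` and `e'` mention `Leg b` and would block the rewrite. The Liouville form
  -- ignores `w`, and `e'` is generalized together with `h`.
  clear w
  revert e'
  rw [hLeg]
  intro e' h
  obtain rfl : e = e' := eq_of_heq (TotalSpace.mk.inj h).2
  rfl

open ProlongationSection

theorem omegaHamiltonian_eq_omegaLagrangian [FiniteDimensional ℝ F]
    (hLeg : ∀ b, Leg b = legendre L b) {Z W : VelocitySection k 𝒜} {Z' W' : MomentumSection k 𝒜}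
    (hZ : IsRelated Leg Z Z') (hW : IsRelated Leg W W') (A : Fin k) (b : VelocitySpace k F E) :
    omegaHamiltonian A Z' W' (Leg b) = omegaLagrangian L A Z W b := by
  -- Naturality of the Lie bracket requires complete model spaces; here finite dimension supplies
  -- completeness.
  have : CompleteSpace B := FiniteDimensional.complete ℝ B
  have : CompleteSpace F := FiniteDimensional.complete ℝ F
  exact congrArg Neg.neg (hZ.extDiff_eq (proj_comp_of_eq_legendre hLeg) hW
    (fun b e e' v h => poincareCartan_eq_liouvilleForm hLeg A b e e' v _ h) b)

/-- A tuple of sections solves the Euler–Lagrange equations if and only if the tuple related to it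
by the Legendre transformation solves the Hamilton equations. -/
theorem solvesHamilton_iff_solvesEulerLagrange [FiniteDimensional ℝ F]
    (hLeg : ∀ b, Leg b = legendre L b) {ξL : Fin k → VelocitySection k 𝒜}
    {ξH : Fin k → MomentumSection k 𝒜} (h : ∀ A, (ξL A).IsRelated Leg (ξH A)) :
    SolvesHamilton (energy B L ∘ Leg.symm) ξH ↔ SolvesEulerLagrange L ξL := by
  -- For a related pair of test sections the two equations agree term by term: `Ω^A` pulls back to
  -- `Ω_L^A`, and `dH` to `dE_L`.
  have key {W : VelocitySection k 𝒜} {W' : MomentumSection k 𝒜} (hW : W.IsRelated Leg W')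
      (b : VelocitySpace k F E) :
      (∑ A, omegaHamiltonian A (ξH A) W' (Leg b) =
        mvfderiv (momentumModel k B F) (energy B L ∘ Leg.symm) (Leg b) (W'.snd (Leg b))) ↔
      (∑ A, omegaLagrangian L A (ξL A) W b =
        mvfderiv (velocityModel k B F) (energy B L) b (W.snd b)) := by
    have hE : (energy B L ∘ Leg.symm) ∘ Leg = energy B L :=
      funext fun b => congrArg (energy B L) (Leg.symm_apply_apply b)
    rw [Finset.sum_congr rfl fun A _ => omegaHamiltonian_eq_omegaLagrangian hLeg (h A) hW A b,
      hW.snd_eq, ← Leg.mvfderiv_comp_apply, hE]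
  -- Each equation quantifies over all test sections, so the first direction pushes a given `W`
  -- forward and the second pulls a given `W'` back.
  constructor
  · intro hH W b
    obtain ⟨W', hW⟩ := exists_isRelated_to_of_diffeomorph Leg (proj_comp_of_eq_legendre hLeg) W
    exact (key hW b).1 (hH W' (Leg b))
  · intro hL W' c
    obtain ⟨W, hW⟩ := exists_isRelated_of_diffeomorph Leg (proj_comp_of_eq_legendre hLeg) W'
    have := (key hW (Leg.symm c)).2 (hL W (Leg.symm c))
    rwa [Leg.apply_symm_apply] at this

omit [FiniteDimensional ℝ B] [T2Space Q] in
theorem toMap_eq_of_isRelated_legendre (hLeg : ∀ b, Leg b = legendre L b)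
    {Z : VelocitySection k 𝒜} {Z' : MomentumSection k 𝒜} (h : IsRelated Leg Z Z') :
    Z'.toMap = prolongLegendre L ∘ Z.toMap ∘ Leg.symm := by
  funext c
  have hc := h (Leg.symm c)
  rw [Leg.apply_symm_apply, show (Leg : VelocitySpace k F E → MomentumSpace k F E) = legendre L
    from funext hLeg] at hc
  exact hc

end Legendre

end KSymplectic

/-! ### The equivalence of the two formalisms. -/

theorem theorem4
    {B : Type*} [NormedAddCommGroup B] [NormedSpace ℝ B] [FiniteDimensional ℝ B]
    {Q : Type*} [TopologicalSpace Q] [T2Space Q] [SecondCountableTopology Q] [ChartedSpace B Q]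
    [IsManifold 𝓘(ℝ, B) ∞ Q]
    {F : Type*} [NormedAddCommGroup F] [NormedSpace ℝ F] [FiniteDimensional ℝ F]
    {E : Q → Type*} [∀ q, AddCommGroup (E q)] [∀ q, Module ℝ (E q)]
    [∀ q, TopologicalSpace (E q)] [TopologicalSpace (TotalSpace F E)]
    [FiberBundle F E] [VectorBundle ℝ F E] [ContMDiffVectorBundle ∞ F E 𝓘(ℝ, B)]
    (𝒜 : KSymplectic.LieAlgebroid B F E) (k : ℕ)
    (L : C^∞⟮KSymplectic.velocityModel k B F, KSymplectic.VelocitySpace k F E; 𝓘(ℝ, ℝ), ℝ⟯)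
    (Leg : KSymplectic.VelocitySpace k F E
      ≃ₘ⟮KSymplectic.velocityModel k B F, KSymplectic.momentumModel k B F⟯
      KSymplectic.MomentumSpace k F E)
    (hLeg : ∀ b, Leg b = KSymplectic.legendre L b)
    (H : KSymplectic.MomentumSpace k F E → ℝ)
    (hH : H = KSymplectic.energy B L ∘ Leg.symm) :
    BijOn (fun η : EuclideanSpace ℝ (Fin k) → KSymplectic.VelocitySpace k F E => Leg ∘ η)
      {η | ∃ ξL : Fin k → KSymplectic.VelocitySection k 𝒜,
        KSymplectic.SolvesEulerLagrange L ξL ∧ KSymplectic.IsIntegralSection ξL η}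
      {ψ | ∃ ξH : Fin k → KSymplectic.MomentumSection k 𝒜,
        KSymplectic.SolvesHamilton H ξH ∧ KSymplectic.IsIntegralSection ξH ψ} ∧
    (∀ ξL : Fin k → KSymplectic.VelocitySection k 𝒜, KSymplectic.SolvesEulerLagrange L ξL →
      ∃ ξH : Fin k → KSymplectic.MomentumSection k 𝒜, KSymplectic.SolvesHamilton H ξH ∧
        (∀ A, (ξH A).toMap = KSymplectic.prolongLegendre L ∘ (ξL A).toMap ∘ Leg.symm) ∧
        ∀ η : EuclideanSpace ℝ (Fin k) → KSymplectic.VelocitySpace k F E,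
          KSymplectic.IsIntegralSection ξL η → KSymplectic.IsIntegralSection ξH (Leg ∘ η)) ∧
    (∀ ξH : Fin k → KSymplectic.MomentumSection k 𝒜, KSymplectic.SolvesHamilton H ξH →
      ∃ ξL : Fin k → KSymplectic.VelocitySection k 𝒜, KSymplectic.SolvesEulerLagrange L ξL ∧
        (∀ A, (ξH A).toMap = KSymplectic.prolongLegendre L ∘ (ξL A).toMap ∘ Leg.symm) ∧
        ∀ ψ : EuclideanSpace ℝ (Fin k) → KSymplectic.MomentumSpace k F E,
          KSymplectic.IsIntegralSection ξH ψ → KSymplectic.IsIntegralSection ξL (Leg.symm ∘ ψ)) := by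
  have hpr := KSymplectic.proj_comp_of_eq_legendre hLeg
  subst hH
  have toH (ξL : Fin k → KSymplectic.VelocitySection k 𝒜)
      (hξL : KSymplectic.SolvesEulerLagrange L ξL) :
      ∃ ξH : Fin k → KSymplectic.MomentumSection k 𝒜,
        KSymplectic.SolvesHamilton (KSymplectic.energy B L ∘ Leg.symm) ξH ∧
        (∀ A, (ξH A).toMap = KSymplectic.prolongLegendre L ∘ (ξL A).toMap ∘ Leg.symm) ∧
        ∀ η : EuclideanSpace ℝ (Fin k) → KSymplectic.VelocitySpace k F E,
          KSymplectic.IsIntegralSection ξL η → KSymplectic.IsIntegralSection ξH (Leg ∘ η) := by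
    choose ξH h using fun A =>
      KSymplectic.ProlongationSection.exists_isRelated_to_of_diffeomorph Leg hpr (ξL A)
    exact ⟨ξH, (KSymplectic.solvesHamilton_iff_solvesEulerLagrange hLeg h).2 hξL,
      fun A => KSymplectic.toMap_eq_of_isRelated_legendre hLeg (h A),
      fun η hη => hη.comp_of_isRelated h⟩
  have toL (ξH : Fin k → KSymplectic.MomentumSection k 𝒜)
      (hξH : KSymplectic.SolvesHamilton (KSymplectic.energy B L ∘ Leg.symm) ξH) :
      ∃ ξL : Fin k → KSymplectic.VelocitySection k 𝒜, KSymplectic.SolvesEulerLagrange L ξL ∧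
        (∀ A, (ξH A).toMap = KSymplectic.prolongLegendre L ∘ (ξL A).toMap ∘ Leg.symm) ∧
        ∀ ψ : EuclideanSpace ℝ (Fin k) → KSymplectic.MomentumSpace k F E,
          KSymplectic.IsIntegralSection ξH ψ →
            KSymplectic.IsIntegralSection ξL (Leg.symm ∘ ψ) := by
    choose ξL h using fun A =>
      KSymplectic.ProlongationSection.exists_isRelated_of_diffeomorph Leg hpr (ξH A)
    exact ⟨ξL, (KSymplectic.solvesHamilton_iff_solvesEulerLagrange hLeg h).1 hξH,
      fun A => KSymplectic.toMap_eq_of_isRelated_legendre hLeg (h A),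
      -- Relatedness under `Leg` is also relatedness under `Leg.symm`, so the transport of integral
      -- sections applies backwards.
      fun ψ hψ => hψ.comp_of_isRelated fun A => (h A).symm⟩
  refine ⟨⟨?_, ?_, ?_⟩, toH, toL⟩
  · rintro η ⟨ξL, hξL, hη⟩
    obtain ⟨ξH, hξH, -, h⟩ := toH ξL hξL
    exact ⟨ξH, hξH, h η hη⟩
  · exact fun η _ η' _ h => funext fun t => Leg.injective (congrFun h t)
  · rintro ψ ⟨ξH, hξH, hψ⟩
    obtain ⟨ξL, hξL, -, h⟩ := toL ξH hξH
    exact ⟨Leg.symm ∘ ψ, ⟨ξL, hξL, h ψ hψ⟩, funext fun t => Leg.apply_symm_apply (ψ t)⟩
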